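/- An $r$-colored permutation of $[n]=\{1,\dots,n\}$ (an element of $\mathbb{Z}_r\wr\mathfrak{S}_n$) is a pair $w=(\sigma,\varepsilon)$ with $\sigma\in\mathfrak{S}_n$ and $\varepsilon\in\{0,\dots,r-1\}^n$; $\varepsilon_k$ is the color of $w(k)$, and $w(k)$ is compared through its value $\sigma(k)$ in chains such as $w(1)>w(2)>\cdots$ of letters of equal color. Put $\sigma(n+1):=n+1$ and $\varepsilon_{n+1}:=0$. An index $k\in[n]$ is a descent of $w$ if $\varepsilon_k>\varepsilon_{k+1}$, or $\varepsilon_k=\varepsilon_{k+1}$ and $\sigma(k)>\sigma(k+1)$; $\mathrm{des}(w)$ is the number of descents, and $\mathrm{Asc}(w)\subseteq[n]$ is the set of indices that are not descents. Let $$A_{n,r}(t)=\sum_{w\in\mathbb{Z}_r\wr\mathfrak{S}_n}t^{\mathrm{des}(w)},\qquad \widetilde A_{n,r}(t)=\sum_{m=0}^n\binom nm t^{n-m}A_{m,r}(t),\qquad A_{0,r}(t):=1.$$ For $n\ge1$ let $\xi^+_{n,r,i}$ be the number of $w\in\mathbb{Z}_r\wr\mathfrak{S}_n$ for which $\mathrm{Asc}(w)\subseteq[2,n]$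 has exactly $i$ elements, no two consecutive, and contains $n$; let $\xi^-_{n,r,i}$ be the number of $w\in\mathbb{Z}_r\wr\mathfrak{S}_n$ for which $\mathrm{Asc}(w)\subseteq[2,n-1]$ has exactly $i-1$ elements, no two consecutive. Put $\xi^+_{0,r,0}:=1$, $\xi^+_{0,r,i}:=0$ for $i\ge1$, and $\xi^-_{0,r,i}:=0$. Define $d^+_{0,r}(t):=1$, $d^-_{0,r}(t):=0$ and, for $n\ge1$, the two parts of the colored derangement polynomial $$d^+_{n,r}(t)=\sum_{i=1}^{\lfloor n/2\rfloor}\xi^+_{n,r,i}\,t^i(1+t)^{n-2i},\qquad d^-_{n,r}(t)=\sum_{i=1}^{\lfloor (n+1)/2\rfloor}\xi^-_{n,r,i}\,t^i(1+t)^{n+1-2i}.$$ Finally let $$A^{\pm}_{n,r}(t)=\sum_{k=0}^n\binom nk d^{\pm}_{k,r}(t),\qquad \widetilde A^{\pm}_{n,r}(t)=\sum_{m=0}^n\binom nm t^{n-m}A^{\pm}_{m,r}(t).$$ **Corollary.** For all positive integers $n,r$ with $r\ge2$ we have $\widetilde A_{n,r}(t)=\widetilde A^+_{n,r}(t)+\widetilde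 A^-_{n,r}(t)$ and $$\widetilde A^+_{n,r}(t)=\sum_{i=0}^{\lfloor n/2\rfloor}\widetilde\gamma^+_{n,r,i}\,t^i(1+t)^{n-2i},\qquad \widetilde A^-_{n,r}(t)=\sum_{i=1}^{\lfloor (n+1)/2\rfloor}\widetilde\gamma^-_{n,r,i}\,t^i(1+t)^{n+1-2i},$$ where $$\widetilde\gamma^+_{n,r,i}:=\sum_{k=2i}^n\binom nk\xi^+_{k,r,i}\quad(i\ge0),\qquad \widetilde\gamma^-_{n,r,i}:=\sum_{k=2i-1}^n\binom nk\xi^-_{k,r,i}\quad(i\ge1).$$ Moreover: * for every $i\ge0$, $\widetilde\gamma^+_{n,r,i}$ is equal to the number of $w\in\mathbb{Z}_r\wr\mathfrak{S}_{n+1}$ for which $\mathrm{Asc}(w)$ has exactly $i+1$ elements, no two consecutive, and contains $n+1$, and for which $w(1)>w(2)>\cdots>w(m)=1$ have all zero color, for some $m\ge1$; * for every $i\ge1$, $\widetilde\gamma^-_{n,r,i}$ is equal to the number of $w\in\mathbb{Z}_r\wr\mathfrak{S}_{n+1}$ for which $\mathrm{Asc}(w)\subseteq[n]$ has exactly $i$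 elements, no two consecutive, and for which $w(1)>w(2)>\cdots>w(m)=1$ have all zero color, for some $m\ge1$. -/

import Mathlib

open Polynomial

namespace ColoredEulerian

/-- An `r`-colored permutation of `[n]`: a pair `(σ, ε)` of a permutation `σ` of `[n]` and a
word `ε` of `n` colors in `{0, …, r - 1}`. Positions and values are stored shifted down by one;
`value` and `color` below return to the usual numbering `1, …, n`. -/
abbrev ColoredPerm (n r : ℕ) : Type := Equiv.Perm (Fin n) × (Fin n → Fin r)

variable {n r : ℕ}

/-- `σ(k)` for `1 ≤ k ≤ n`, with `σ(k) = k` at all other `k`; in particular `σ(n+1) = n+1`. -/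
def value (w : ColoredPerm n r) (k : ℕ) : ℕ :=
  if h : 1 ≤ k ∧ k ≤ n then (w.1 ⟨k - 1, by omega⟩ : ℕ) + 1 else k

/-- `ε_k` for `1 ≤ k ≤ n`, and `0` at all other `k`; in particular `ε_{n+1} = 0`. -/
def color (w : ColoredPerm n r) (k : ℕ) : ℕ :=
  if h : 1 ≤ k ∧ k ≤ n then (w.2 ⟨k - 1, by omega⟩ : ℕ) else 0

/-- The set of descents `k ∈ [n]` of a colored permutation. -/
def Des (w : ColoredPerm n r) : Finset ℕ :=
  (Finset.Icc 1 n).filter fun k =>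
    color w (k + 1) < color w k ∨ (color w k = color w (k + 1) ∧ value w (k + 1) < value w k)

/-- The set of ascents: the complement of the descent set in `[n]`. -/
def Asc (w : ColoredPerm n r) : Finset ℕ := Finset.Icc 1 n \ Des w

/-- No two elements of `S` are consecutive integers. -/
def NoTwoConsecutive (S : Finset ℕ) : Prop := ∀ k ∈ S, k + 1 ∉ S

/-- For some `m`, `w(1) > w(2) > ⋯ > w(m) = 1` and these `m` letters all have color zero. -/
def StartsDecreasingToOne (w : ColoredPerm n r) : Prop :=
  ∃ m ∈ Finset.Icc 1 n,
    (∀ k ∈ Finset.Icc 1 m, color w k = 0) ∧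
    (∀ k, 1 ≤ k → k < m → value w (k + 1) < value w k) ∧
    value w m = 1

/-- The Eulerian polynomial of the wreath product of `ℤ/r` and the symmetric group on `[n]`. -/
noncomputable def eulerian (n r : ℕ) : ℕ[X] :=
  ∑ w : ColoredPerm n r, X ^ (Des w).card

/-- The colored binomial Eulerian polynomial. -/
noncomputable def binomialEulerian (n r : ℕ) : ℕ[X] :=
  ∑ m ∈ Finset.range (n + 1), (n.choose m : ℕ[X]) * X ^ (n - m) * eulerian m r

/-- `ξ⁺_{n,r,i}`: for `n ≥ 1` the number of `w` for which `Asc w ⊆ [2, n]` has exactly `i`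
elements, no two consecutive, and contains `n`; for `n = 0` it is `1` if `i = 0` and `0`
otherwise, in accordance with `d⁺_{0,r} = 1`. -/
noncomputable def xiPlus (n r i : ℕ) : ℕ :=
  if n = 0 then (if i = 0 then 1 else 0)
  else Nat.card {w : ColoredPerm n r //
    Asc w ⊆ Finset.Icc 2 n ∧ (Asc w).card = i ∧ NoTwoConsecutive (Asc w) ∧ n ∈ Asc w}

/-- `ξ⁻_{n,r,i}`: for `n ≥ 1` the number of `w` for which `Asc w ⊆ [2, n - 1]` has exactly
`i - 1` elements, no two consecutive; for `n = 0` it is `0`, in accordance with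
`d⁻_{0,r} = 0`. -/
noncomputable def xiMinus (n r i : ℕ) : ℕ :=
  if n = 0 then 0
  else Nat.card {w : ColoredPerm n r //
    Asc w ⊆ Finset.Icc 2 (n - 1) ∧ (Asc w).card + 1 = i ∧ NoTwoConsecutive (Asc w)}

/-- `d⁺_{n,r}(t)`, the part with center `n/2` of the colored derangement polynomial. -/
noncomputable def derangementPlus (n r : ℕ) : ℕ[X] :=
  if n = 0 then 1
  else ∑ i ∈ Finset.Icc 1 (n / 2), (xiPlus n r i : ℕ[X]) * X ^ i * (1 + X) ^ (n - 2 * i)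

/-- `d⁻_{n,r}(t)`, the part with center `(n+1)/2` of the colored derangement polynomial. -/
noncomputable def derangementMinus (n r : ℕ) : ℕ[X] :=
  if n = 0 then 0
  else ∑ i ∈ Finset.Icc 1 ((n + 1) / 2),
    (xiMinus n r i : ℕ[X]) * X ^ i * (1 + X) ^ (n + 1 - 2 * i)

/-- `A⁺_{n,r}(t)`. -/
noncomputable def eulerianPlus (n r : ℕ) : ℕ[X] :=
  ∑ k ∈ Finset.range (n + 1), (n.choose k : ℕ[X]) * derangementPlus k r

/-- `A⁻_{n,r}(t)`. -/
noncomputable def eulerianMinus (n r : ℕ) : ℕ[X] :=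
  ∑ k ∈ Finset.range (n + 1), (n.choose k : ℕ[X]) * derangementMinus k r

/-- `Ã⁺_{n,r}(t)`. -/
noncomputable def binomialEulerianPlus (n r : ℕ) : ℕ[X] :=
  ∑ m ∈ Finset.range (n + 1), (n.choose m : ℕ[X]) * X ^ (n - m) * eulerianPlus m r

/-- `Ã⁻_{n,r}(t)`. -/
noncomputable def binomialEulerianMinus (n r : ℕ) : ℕ[X] :=
  ∑ m ∈ Finset.range (n + 1), (n.choose m : ℕ[X]) * X ^ (n - m) * eulerianMinus m r

/-- The coefficient `γ̃⁺_{n,r,i}`, a binomial sum of the `ξ⁺_{k,r,i}`. -/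
noncomputable def gammaPlus (n r i : ℕ) : ℕ :=
  ∑ k ∈ Finset.Icc (2 * i) n, n.choose k * xiPlus k r i

/-- The coefficient `γ̃⁻_{n,r,i}` (`i ≥ 1`), a binomial sum of the `ξ⁻_{k,r,i}`. The sum starts
at `k = 2i - 1`, the least `k` for which `t^i (1+t)^{k+1-2i}` occurs in `d⁻_{k,r}(t)`. -/
noncomputable def gammaMinus (n r i : ℕ) : ℕ :=
  ∑ k ∈ Finset.Icc (2 * i - 1) n, n.choose k * xiMinus k r i

end ColoredEulerian

open ColoredEulerian

namespace ColoredEulerian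

/-! ### Ascents in terms of letters -/

section Basic

variable {n r : ℕ}

/-! The main tool is to cut a colored permutation after its first `k` letters (`glue_bijective`):
ascents away from the cut are inherited from the two pieces, and a decreasing piece is determined by
the colors of its values (`sum_decreasing`).

For the decomposition it suffices that A is the binomial transform of D = d⁺ + d⁻. Both t^des and
the weight behind D are products over the gaps between ascents (`IsGapProduct`), and expanding the
first gap gives a recursion for their sums (`IsGapProduct.sum_eq`). With e(c) = exp(cx), the
exponential generating functions satisfy A·(t − e((t−1)r)) = (t−1)·e((t−1)(r−1)) and D·(t·e(r) −
e(tr)) = (t−1)·e(t(r−1)). Multiplying the second by e(1−r) yields A = D·e(1)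
(`sum_eulerian_weight_eq`).

For the expansions, the two binomial transforms compose to Σ C(n,k) d_k (1+t)^(n−k)
(`sum_choose_pow_mul_sum_choose`); the extra power of 1+t moves all terms to a common center.

For the counts, a zero-colored start w(1) > ⋯ > w(m) = 1 ends exactly at the first ascent. Cutting
there leaves an arbitrary colored permutation of k = n+1−m letters, with C(n,k) choices of values
(`card_startsDecreasingToOne`). -/

theorem value_succ (w : ColoredPerm n r) {i : ℕ} (h : i < n) :
    value w (i + 1) = (w.1 ⟨i, h⟩ : ℕ) + 1 := by
  simp [value, h]

theorem color_succ (w : ColoredPerm n r) {i : ℕ} (h : i < n) :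
    color w (i + 1) = (w.2 ⟨i, h⟩ : ℕ) := by
  simp [color, h]

theorem value_last (w : ColoredPerm n r) : value w (n + 1) = n + 1 := by
  simp [value]

theorem color_last (w : ColoredPerm n r) : color w (n + 1) = 0 := by
  simp [color]

theorem mem_Asc {w : ColoredPerm n r} {k : ℕ} :
    k ∈ Asc w ↔ (1 ≤ k ∧ k ≤ n) ∧ ¬ (color w (k + 1) < color w k ∨
      (color w k = color w (k + 1) ∧ value w (k + 1) < value w k)) := by
  simp only [Asc, Des, Finset.mem_sdiff, Finset.mem_filter, Finset.mem_Icc]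
  tauto

theorem Asc_subset (w : ColoredPerm n r) : Asc w ⊆ Finset.Icc 1 n := Finset.sdiff_subset

theorem card_Des (w : ColoredPerm n r) : (Des w).card = n - (Asc w).card := by
  have h : Des w ⊆ Finset.Icc 1 n := Finset.filter_subset _ _
  have h1 := Finset.card_le_card h
  rw [Asc, Finset.card_sdiff_of_subset h]
  simp only [Nat.card_Icc, Nat.add_sub_cancel] at h1 ⊢
  omega

end Basic

/-! ### Cutting and gluing colored permutations -/

section Glue

variable {k l r : ℕ}

/-- The colored permutation whose first `k` values form the set `A`, in the relative order given
by `u`, and whose remaining values are in the relative order given by `v`. -/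
def glue (A : {A : Finset (Fin (k + l)) // A.card = k}) (u : ColoredPerm k r)
    (v : ColoredPerm l r) : ColoredPerm (k + l) r :=
  (finSumFinEquiv.symm.trans ((Equiv.sumCongr u.1 v.1).trans
    (finSumEquivOfFinset A.2 (by rw [Finset.card_compl, A.2, Fintype.card_fin]; omega))),
    Fin.append u.2 v.2)

theorem card_compl_of_card (A : {A : Finset (Fin (k + l)) // A.card = k}) :
    (A.1ᶜ).card = l := by
  rw [Finset.card_compl, A.2, Fintype.card_fin]; omega

theorem glue_fst_castAdd (A : {A : Finset (Fin (k + l)) // A.card = k}) (u : ColoredPerm k r)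
    (v : ColoredPerm l r) (i : Fin k) :
    (glue A u v).1 (Fin.castAdd l i) = A.1.orderEmbOfFin A.2 (u.1 i) := by
  simp [glue]

theorem glue_fst_natAdd (A : {A : Finset (Fin (k + l)) // A.card = k}) (u : ColoredPerm k r)
    (v : ColoredPerm l r) (i : Fin l) :
    (glue A u v).1 (Fin.natAdd k i) = (A.1ᶜ).orderEmbOfFin (card_compl_of_card A) (v.1 i) := by
  simp [glue]

theorem mem_iff_glue (A : {A : Finset (Fin (k + l)) // A.card = k}) (u : ColoredPerm k r)
    (v : ColoredPerm l r) (x : Fin (k + l)) :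
    x ∈ A.1 ↔ ∃ i : Fin k, (glue A u v).1 (Fin.castAdd l i) = x := by
  constructor
  · intro hx
    have : x ∈ Set.range (A.1.orderEmbOfFin A.2) := by
      rw [Finset.range_orderEmbOfFin]; exact hx
    obtain ⟨j, rfl⟩ := this
    exact ⟨u.1.symm j, by rw [glue_fst_castAdd, Equiv.apply_symm_apply]⟩
  · rintro ⟨i, rfl⟩
    rw [glue_fst_castAdd]
    exact Finset.orderEmbOfFin_mem _ _ _

/-- `A` is recovered as the set of the first `k` values, which gives injectivity; the cardinalities
agree by C(k+l,k)·k!·l! = (k+l)!. -/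
theorem glue_bijective : Function.Bijective
    (fun p : {A : Finset (Fin (k + l)) // A.card = k} × ColoredPerm k r × ColoredPerm l r =>
      glue p.1 p.2.1 p.2.2) := by
  rw [Fintype.bijective_iff_injective_and_card]
  constructor
  · rintro ⟨A, u, v⟩ ⟨A', u', v'⟩ h
    simp only at h
    have hA : A = A' := by
      ext x
      rw [mem_iff_glue A u v, mem_iff_glue A' u' v', h]
    subst hA
    have h2 : Fin.append u.2 v.2 = Fin.append u'.2 v'.2 := congrArg Prod.snd h
    have hu : u = u' := by
      refine Prod.ext (Equiv.ext fun i => ?_) (funext fun i => ?_)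
      · have := congrArg (fun w => w.1 (Fin.castAdd l i)) h
        simpa [glue_fst_castAdd] using this
      · simpa using congrFun h2 (Fin.castAdd l i)
    have hv : v = v' := by
      refine Prod.ext (Equiv.ext fun i => ?_) (funext fun i => ?_)
      · have := congrArg (fun w => w.1 (Fin.natAdd k i)) h
        simpa [glue_fst_natAdd] using this
      · simpa using congrFun h2 (Fin.natAdd k i)
    rw [hu, hv]
  · have := Nat.add_choose_mul_factorial_mul_factorial k l
    simp only [Fintype.card_prod, Fintype.card_perm, Fintype.card_fin, Fintype.card_fun,
      Fintype.card_finset_len]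
    rw [← this, pow_add, Nat.choose_symm_add]
    ring

theorem sum_eq_sum_glue {M : Type*} [AddCommMonoid M] (F : ColoredPerm (k + l) r → M) :
    ∑ w, F w = ∑ A : {A : Finset (Fin (k + l)) // A.card = k}, ∑ u : ColoredPerm k r,
      ∑ v : ColoredPerm l r, F (glue A u v) := by
  rw [← (Equiv.ofBijective _ (glue_bijective (k := k) (l := l) (r := r))).sum_comp,
    Fintype.sum_prod_type]
  refine Finset.sum_congr rfl fun A _ => ?_
  rw [Fintype.sum_prod_type]
  rfl

theorem color_glue_left (A : {A : Finset (Fin (k + l)) // A.card = k}) (u : ColoredPerm k r)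
    (v : ColoredPerm l r) {i : ℕ} (hi : i < k) :
    color (glue A u v) (i + 1) = color u (i + 1) := by
  rw [color_succ _ (show i < k + l by omega), color_succ _ hi]
  exact congrArg Fin.val (Fin.append_left u.2 v.2 ⟨i, hi⟩)

theorem value_glue_left (A : {A : Finset (Fin (k + l)) // A.card = k}) (u : ColoredPerm k r)
    (v : ColoredPerm l r) {i : ℕ} (hi : i < k) :
    value (glue A u v) (i + 1) = (A.1.orderEmbOfFin A.2 (u.1 ⟨i, hi⟩) : ℕ) + 1 := by
  rw [value_succ _ (show i < k + l by omega)]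
  exact congrArg (fun x : Fin (k + l) => (x : ℕ) + 1) (glue_fst_castAdd A u v ⟨i, hi⟩)

theorem value_glue_left_lt (A : {A : Finset (Fin (k + l)) // A.card = k}) (u : ColoredPerm k r)
    (v : ColoredPerm l r) {i j : ℕ} (hi : i < k) (hj : j < k) :
    value (glue A u v) (i + 1) < value (glue A u v) (j + 1) ↔
      value u (i + 1) < value u (j + 1) := by
  rw [value_glue_left A u v hi, value_glue_left A u v hj, value_succ u hi, value_succ u hj,
    add_lt_add_iff_right, add_lt_add_iff_right, Fin.val_fin_lt, Fin.val_fin_lt,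
    OrderEmbedding.lt_iff_lt]

theorem color_glue_right (A : {A : Finset (Fin (k + l)) // A.card = k}) (u : ColoredPerm k r)
    (v : ColoredPerm l r) {i : ℕ} (hi : i ≤ l) :
    color (glue A u v) (k + i + 1) = color v (i + 1) := by
  rcases hi.lt_or_eq with hi | rfl
  · rw [color_succ _ (show k + i < k + l by omega), color_succ _ hi]
    exact congrArg Fin.val (Fin.append_right u.2 v.2 ⟨i, hi⟩)
  · rw [color_last, color_last]

theorem value_glue_right (A : {A : Finset (Fin (k + l)) // A.card = k}) (u : ColoredPerm k r)
    (v : ColoredPerm l r) {i : ℕ} (hi : i < l) :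
    value (glue A u v) (k + i + 1) =
      ((A.1ᶜ).orderEmbOfFin (card_compl_of_card A) (v.1 ⟨i, hi⟩) : ℕ) + 1 := by
  rw [value_succ _ (show k + i < k + l by omega)]
  exact congrArg (fun x : Fin (k + l) => (x : ℕ) + 1) (glue_fst_natAdd A u v ⟨i, hi⟩)

/-- The case `i = l` is the conventional last letter, which exceeds all values both before and after
gluing. -/
theorem value_glue_right_lt (A : {A : Finset (Fin (k + l)) // A.card = k}) (u : ColoredPerm k r)
    (v : ColoredPerm l r) {i j : ℕ} (hi : i ≤ l) (hj : j < l) :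
    value (glue A u v) (k + i + 1) < value (glue A u v) (k + j + 1) ↔
      value v (i + 1) < value v (j + 1) := by
  rcases hi.lt_or_eq with hi | rfl
  · rw [value_glue_right A u v hi, value_glue_right A u v hj, value_succ v hi, value_succ v hj,
      add_lt_add_iff_right, add_lt_add_iff_right, Fin.val_fin_lt, Fin.val_fin_lt,
      OrderEmbedding.lt_iff_lt]
  · rw [value_last, value_last, value_succ v hj, value_glue_right A u v hj]
    have h1 := (v.1 ⟨j, hj⟩).2
    have h2 := ((A.1ᶜ).orderEmbOfFin (card_compl_of_card A) (v.1 ⟨j, hj⟩)).2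
    omega

/-- Position `k` is excluded: there `u` compares with its own conventional letter, the glued word
with what follows the cut. -/
theorem mem_Asc_glue_left (A : {A : Finset (Fin (k + l)) // A.card = k}) (u : ColoredPerm k r)
    (v : ColoredPerm l r) {j : ℕ} (hj : j < k) :
    j ∈ Asc (glue A u v) ↔ j ∈ Asc u := by
  rcases j with _ | j
  · simp [mem_Asc]
  rw [mem_Asc, mem_Asc, color_glue_left A u v hj, color_glue_left A u v (by omega),
    value_glue_left_lt A u v hj (by omega)]
  have : j + 1 ≤ k + l := by omega
  have : j + 1 ≤ k := by omega
  simp [*]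

theorem mem_Asc_glue_right (A : {A : Finset (Fin (k + l)) // A.card = k}) (u : ColoredPerm k r)
    (v : ColoredPerm l r) {j : ℕ} (hj : 1 ≤ j) :
    k + j ∈ Asc (glue A u v) ↔ j ∈ Asc v := by
  obtain ⟨j, rfl⟩ := Nat.exists_eq_add_of_le' hj
  by_cases hjl : j < l
  · have hc : color (glue A u v) (k + (j + 1)) = color v (j + 1) :=
      color_glue_right A u v hjl.le
    have hc' : color (glue A u v) (k + (j + 1) + 1) = color v (j + 1 + 1) :=
      color_glue_right A u v hjl
    have hv : value (glue A u v) (k + (j + 1) + 1) < value (glue A u v) (k + (j + 1)) ↔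
        value v (j + 1 + 1) < value v (j + 1) := value_glue_right_lt A u v hjl hjl
    rw [mem_Asc, mem_Asc, hc, hc', hv]
    have : k + (j + 1) ≤ k + l := by omega
    have : j + 1 ≤ l := by omega
    have : 1 ≤ k + (j + 1) := by omega
    simp [*]
  · rw [mem_Asc, mem_Asc]
    constructor <;> · rintro ⟨h, -⟩; omega

end Glue

/-! ### Decreasing words -/

section Decreasing

variable {k r : ℕ}

/-- The letters of a colored permutation, ordered by color and then by value. -/
def letter (w : ColoredPerm k r) (i : Fin k) : Fin r ×ₗ Fin k := toLex (w.2 i, w.1 i)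

theorem letter_lt_letter (w : ColoredPerm k r) (i j : Fin k) :
    letter w i < letter w j ↔ color w (i + 1) < color w (j + 1) ∨
      (color w (j + 1) = color w (i + 1) ∧ value w (i + 1) < value w (j + 1)) := by
  rw [letter, letter, Prod.Lex.toLex_lt_toLex, color_succ w i.2, color_succ w j.2,
    value_succ w i.2, value_succ w j.2, add_lt_add_iff_right, Fin.val_fin_lt, Fin.val_fin_lt,
    Fin.val_inj, eq_comm (a := w.2 j)]

theorem forall_mem_Asc_le_iff (w : ColoredPerm k r) :
    (∀ j ∈ Asc w, k ≤ j) ↔ StrictAnti (letter w) := by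
  rcases k with _ | k
  · simp [StrictAnti]
  rw [Fin.strictAnti_iff_succ_lt]
  constructor
  · intro h i
    rw [letter_lt_letter]
    by_contra hc
    have hi : (i : ℕ) + 1 ∈ Asc w := by
      rw [mem_Asc]
      exact ⟨by omega, by simpa using hc⟩
    have := h _ hi
    omega
  · intro h j hj
    by_contra hc
    obtain ⟨⟨h1, h2⟩, h3⟩ := mem_Asc.1 hj
    obtain ⟨i, rfl⟩ := Nat.exists_eq_add_of_le' h1
    have := h ⟨i, by omega⟩
    rw [letter_lt_letter] at this
    exact h3 (by simpa using this)

/-- With the colors attached to values, `Tuple.sort c` is the only arrangement increasing by color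
and then by value; its reversal is the only decreasing one. -/
theorem strictAnti_letter_iff (σ : Equiv.Perm (Fin k)) (c : Fin k → Fin r) :
    StrictAnti (letter (σ, c ∘ σ)) ↔ σ = Fin.revPerm.trans (Tuple.sort c) := by
  have h1 : σ = Fin.revPerm.trans (Tuple.sort c) ↔ Fin.revPerm.trans σ = Tuple.sort c := by
    constructor
    · rintro rfl; ext i; simp
    · intro h; rw [← h]; ext i; simp
  rw [h1, Tuple.eq_sort_iff']
  constructor
  · intro h i j hij
    exact h (Fin.rev_lt_rev.2 hij)
  · intro h i j hij
    have h' := h (Fin.rev_lt_rev.2 hij)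
    have h'' : Tuple.graphEquiv₁ c (σ j) < Tuple.graphEquiv₁ c (σ i) := by simpa using h'
    exact h''

/-- A colored permutation is given by its underlying permutation and the colors of its values. -/
def valueColorEquiv (k r : ℕ) :
    Equiv.Perm (Fin k) × (Fin k → Fin r) ≃ ColoredPerm k r where
  toFun p := (p.1, p.2 ∘ p.1)
  invFun w := (w.1, w.2 ∘ w.1.symm)
  left_inv p := by ext <;> simp
  right_inv p := by ext <;> simp

open Classical in
theorem sum_decreasing {M : Type*} [AddCommMonoid M] (F : (Fin k → Fin r) → M) :
    ∑ w : ColoredPerm k r, (if ∀ j ∈ Asc w, k ≤ j then F (w.2 ∘ w.1.symm) else 0) =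
      ∑ c, F c := by
  rw [← (valueColorEquiv k r).sum_comp, Fintype.sum_prod_type_right]
  refine Finset.sum_congr rfl fun c _ => ?_
  rw [Finset.sum_eq_single (Fin.revPerm.trans (Tuple.sort c))]
  · rw [if_pos]
    · exact congrArg F (by ext; simp [valueColorEquiv])
    · rw [forall_mem_Asc_le_iff]
      exact (strictAnti_letter_iff _ _).2 rfl
  · intro σ _ hσ
    rw [if_neg]
    rw [forall_mem_Asc_le_iff]
    exact fun h => hσ ((strictAnti_letter_iff _ _).1 h)
  · simp

/-- The conventional last letter has color zero and the largest value, so the final position is a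
descent only if the final color is positive; in a decreasing word that color is the least. -/
theorem Asc_eq_empty_iff (w : ColoredPerm k r) :
    Asc w = ∅ ↔ (∀ j ∈ Asc w, k ≤ j) ∧ ∀ x, 0 < ((w.2 ∘ w.1.symm) x : ℕ) := by
  constructor
  · intro h
    have h0 : ∀ j ∈ Asc w, k ≤ j := by simp [h]
    refine ⟨h0, fun x => ?_⟩
    rw [forall_mem_Asc_le_iff] at h0
    rcases k with _ | k
    · exact x.elim0
    have hk : k + 1 ∉ Asc w := by simp [h]
    rw [mem_Asc, color_last, value_last, color_succ w (Nat.lt_succ_self k),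
      value_succ w (Nat.lt_succ_self k)] at hk
    have hlt := (w.1 ⟨k, Nat.lt_succ_self k⟩).2
    have hpos : 0 < (w.2 (Fin.last k) : ℕ) := by
      by_contra hc
      refine hk ⟨by omega, ?_⟩
      rintro (h | ⟨-, h⟩)
      · exact hc h
      · omega
    have := h0.antitone (Fin.le_last (w.1.symm x))
    rw [letter, letter, Prod.Lex.toLex_le_toLex] at this
    rcases this with h | ⟨h, -⟩
    · exact hpos.trans (Fin.lt_def.1 h)
    · have h' : w.2 (Fin.last k) = w.2 (w.1.symm x) := h
      rw [Function.comp, ← h']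
      exact hpos
  · rintro ⟨h1, h2⟩
    rw [Finset.eq_empty_iff_forall_notMem]
    intro j hj
    have hjk := h1 j hj
    obtain ⟨⟨h3, h4⟩, h5⟩ := mem_Asc.1 hj
    obtain rfl : j = k := le_antisymm h4 hjk
    obtain ⟨i, rfl⟩ := Nat.exists_eq_add_of_le' h3
    refine h5 (Or.inl ?_)
    rw [color_last, color_succ w (Nat.lt_succ_self i)]
    simpa using h2 (w.1 ⟨i, Nat.lt_succ_self i⟩)

open Classical in
theorem card_decreasing (k r : ℕ) :
    ∑ w : ColoredPerm k r, (if ∀ j ∈ Asc w, k ≤ j then 1 else 0) = r ^ k := by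
  rw [sum_decreasing (fun _ => 1)]
  simp

open Classical in
theorem card_Asc_eq_empty (k r : ℕ) :
    ∑ w : ColoredPerm k r, (if Asc w = ∅ then 1 else 0) = (r - 1) ^ k := by
  have := sum_decreasing (k := k) (r := r) (fun c => if ∀ x, 0 < (c x : ℕ) then 1 else 0)
  simp only [← ite_and, ← Asc_eq_empty_iff] at this
  rw [this, ← Finset.card_filter]
  have : Finset.univ.filter (fun c : Fin k → Fin r => ∀ x, 0 < (c x : ℕ)) =
      Fintype.piFinset fun _ => Finset.univ.filter fun a : Fin r => 0 < (a : ℕ) := by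
    ext c; simp
  rw [this, Fintype.card_piFinset_const]
  congr 1
  rcases r with _ | r
  · simp
  · have : Finset.univ.filter (fun a : Fin (r + 1) => 0 < (a : ℕ)) = Finset.univ.erase 0 := by
      ext a
      simp only [Finset.mem_filter, Finset.mem_univ, true_and, Finset.mem_erase, and_true, ne_eq,
        Fin.ext_iff, Fin.val_zero]
      omega
    rw [this, Finset.card_erase_of_mem (Finset.mem_univ _)]
    simp

end Decreasing

/-! ### Ascent sets after a cut -/

/-- The elements of `S` larger than `k`, shifted down by `k`. -/
def shiftDown (k : ℕ) (S : Finset ℕ) : Finset ℕ := (S.filter (k < ·)).image (· - k)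

theorem mem_shiftDown {k : ℕ} {S : Finset ℕ} {j : ℕ} :
    j ∈ shiftDown k S ↔ 1 ≤ j ∧ k + j ∈ S := by
  simp only [shiftDown, Finset.mem_image, Finset.mem_filter]
  constructor
  · rintro ⟨a, ⟨h1, h2⟩, rfl⟩
    exact ⟨by omega, by rwa [Nat.add_sub_cancel' h2.le]⟩
  · rintro ⟨h1, h2⟩
    exact ⟨k + j, ⟨h2, by omega⟩, by omega⟩

theorem shiftDown_shiftDown (k l : ℕ) (S : Finset ℕ) :
    shiftDown l (shiftDown k S) = shiftDown (k + l) S := by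
  ext j
  simp only [mem_shiftDown, add_assoc]
  constructor
  · rintro ⟨h1, -, h2⟩; exact ⟨h1, h2⟩
  · rintro ⟨h1, h2⟩; exact ⟨h1, by omega, h2⟩

theorem shiftDown_subset {k n : ℕ} {S : Finset ℕ} (hS : S ⊆ Finset.Icc 1 n) :
    shiftDown k S ⊆ Finset.Icc 1 (n - k) := by
  intro j hj
  rw [mem_shiftDown] at hj
  have := Finset.mem_Icc.1 (hS hj.2)
  rw [Finset.mem_Icc]; omega

theorem shiftDown_Asc_glue {k l r : ℕ} (A : {A : Finset (Fin (k + l)) // A.card = k})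
    (u : ColoredPerm k r) (v : ColoredPerm l r) : shiftDown k (Asc (glue A u v)) = Asc v := by
  ext j
  rw [mem_shiftDown]
  constructor
  · rintro ⟨h1, h2⟩; exact (mem_Asc_glue_right A u v h1).1 h2
  · intro h
    have h1 := (mem_Asc.1 h).1.1
    exact ⟨h1, (mem_Asc_glue_right A u v h1).2 h⟩

theorem forall_mem_Asc_glue {k l r : ℕ} (A : {A : Finset (Fin (k + l)) // A.card = k})
    (u : ColoredPerm k r) (v : ColoredPerm l r) :
    (∀ j ∈ Asc (glue A u v), k ≤ j) ↔ ∀ j ∈ Asc u, k ≤ j := by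
  constructor
  · intro h j hj
    by_contra hc
    exact hc (h j ((mem_Asc_glue_left A u v (by omega)).2 hj))
  · intro h j hj
    by_contra hc
    exact hc (h j ((mem_Asc_glue_left A u v (by omega)).1 hj))

/-! ### Recursion for gap products -/

section Recursion

variable {R : Type*} [CommRing R]

/-- `f n S` is a product over the gaps of the subset `S` of `[n]`, where a gap of length `m`
before an element of `S` contributes `h m` and the final gap of length `m` contributes `e m`. -/
structure IsGapProduct (f : ℕ → Finset ℕ → R) (h e : ℕ → R) : Prop where
  empty : ∀ n, f n ∅ = e n
  min : ∀ n S, S ⊆ Finset.Icc 1 n → ∀ m ∈ S, (∀ j ∈ S, m ≤ j) →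
    f n S = h m * f (n - m) (shiftDown m S)

-- If `S` has minimum `m`, the terms with `k < m` shorten the first gap to `m - k` and the term `k =
-- m` removes it, so `hh` reassembles `h m`. If `S` is empty, the identity is `he`.
open Classical in
theorem IsGapProduct.eq_add_sum {f : ℕ → Finset ℕ → R} {h e a b : ℕ → R}
    (hf : IsGapProduct f h e)
    (hh : ∀ m, 1 ≤ m → h m = a m + ∑ k ∈ Finset.Ico 1 m, a k * h (m - k))
    (he : ∀ n, e n = b n + ∑ k ∈ Finset.Icc 1 n, a k * e (n - k))
    {n : ℕ} {S : Finset ℕ} (hS : S ⊆ Finset.Icc 1 n) :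
    f n S = (if S = ∅ then b n else 0) + ∑ k ∈ Finset.Icc 1 n,
      if ∀ j ∈ S, k ≤ j then a k * f (n - k) (shiftDown k S) else 0 := by
  rcases S.eq_empty_or_nonempty with rfl | hne
  · have : ∀ k, shiftDown k ∅ = ∅ := fun k => rfl
    simp [hf.empty, this, he n]
  obtain ⟨m, hm, hmin⟩ : ∃ m ∈ S, ∀ j ∈ S, m ≤ j :=
    ⟨S.min' hne, S.min'_mem hne, fun j hj => S.min'_le j hj⟩
  have hmn := Finset.mem_Icc.1 (hS hm)
  rw [if_neg hne.ne_empty, zero_add]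
  have h1 : ∑ k ∈ Finset.Icc 1 n,
      (if ∀ j ∈ S, k ≤ j then a k * f (n - k) (shiftDown k S) else 0) =
      ∑ k ∈ Finset.Ico 1 (m + 1), a k * f (n - k) (shiftDown k S) := by
    rw [← Finset.sum_filter]
    refine Finset.sum_congr ?_ fun _ _ => rfl
    ext k
    simp only [Finset.mem_filter, Finset.mem_Icc, Finset.mem_Ico]
    constructor
    · rintro ⟨h1, h2⟩
      have := h2 m hm
      omega
    · rintro ⟨h1, h2⟩
      exact ⟨by omega, fun j hj => (Nat.lt_succ_iff.1 h2).trans (hmin j hj)⟩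
  rw [h1, Finset.sum_Ico_succ_top hmn.1, hf.min n S hS m hm hmin, hh m hmn.1, add_mul, add_comm,
    Finset.sum_mul]
  congr 1
  refine Finset.sum_congr rfl fun k hk => ?_
  rw [Finset.mem_Ico] at hk
  rw [hf.min (n - k) (shiftDown k S) (shiftDown_subset hS) (m - k), shiftDown_shiftDown,
    Nat.add_sub_cancel' hk.2.le, show n - k - (m - k) = n - m by omega, mul_assoc]
  · rw [mem_shiftDown, Nat.add_sub_cancel' hk.2.le]
    exact ⟨by omega, hm⟩
  · intro j hj
    have := hmin _ (mem_shiftDown.1 hj).2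
    omega

-- The summand does not see whether `k` itself is an ascent, so the cut at `k` separates it: `r ^ k`
-- decreasing first pieces, and a free second piece.
open Classical in
theorem sum_shiftDown_Asc (F : Finset ℕ → R) (k l r : ℕ) :
    ∑ w : ColoredPerm (k + l) r, (if ∀ j ∈ Asc w, k ≤ j then F (shiftDown k (Asc w)) else 0) =
      ((k + l).choose k * r ^ k) * ∑ v : ColoredPerm l r, F (Asc v) := by
  rw [sum_eq_sum_glue]
  simp only [shiftDown_Asc_glue, forall_mem_Asc_glue, Finset.sum_const, Finset.card_univ,
    Fintype.card_finset_len, Fintype.card_fin, nsmul_eq_mul]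
  have := congrArg (Nat.cast : ℕ → R) (card_decreasing k r)
  push_cast at this
  rw [← this, mul_assoc, Finset.sum_mul]
  congr 1
  refine Finset.sum_congr rfl fun u _ => ?_
  split_ifs <;> simp

theorem IsGapProduct.sum_eq {f : ℕ → Finset ℕ → R} {h e a b : ℕ → R}
    (hf : IsGapProduct f h e)
    (hh : ∀ m, 1 ≤ m → h m = a m + ∑ k ∈ Finset.Ico 1 m, a k * h (m - k))
    (he : ∀ n, e n = b n + ∑ k ∈ Finset.Icc 1 n, a k * e (n - k)) (n r : ℕ) :
    ∑ w : ColoredPerm n r, f n (Asc w) = b n * ((r - 1 : ℕ) : R) ^ n +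
      ∑ k ∈ Finset.Icc 1 n, n.choose k * (a k * r ^ k) *
        ∑ v : ColoredPerm (n - k) r, f (n - k) (Asc v) := by
  classical
  rw [Finset.sum_congr rfl fun w _ => hf.eq_add_sum hh he (Asc_subset w), Finset.sum_add_distrib,
    Finset.sum_comm]
  congr 1
  · have := congrArg (Nat.cast : ℕ → R) (card_Asc_eq_empty n r)
    simp only [Nat.cast_sum, Nat.cast_ite, Nat.cast_one, Nat.cast_zero] at this
    rw [← Nat.cast_pow, ← this, Finset.mul_sum]
    refine Finset.sum_congr rfl fun w _ => ?_
    split_ifs <;> simp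
  · refine Finset.sum_congr rfl fun k hk => ?_
    obtain ⟨l, rfl⟩ := Nat.exists_eq_add_of_le (Finset.mem_Icc.1 hk).2
    rw [Nat.add_sub_cancel_left, sum_shiftDown_Asc (fun T => a k * f l T), ← Finset.mul_sum]
    ring

end Recursion

/-! ### Gap identities and sparse sets -/

theorem geom_gap (R : Type*) [CommRing R] (t : R) (n : ℕ) :
    t ^ n = (t - 1) ^ n + ∑ i ∈ Finset.range n, (t - 1) ^ i * t ^ (n - 1 - i) := by
  have := geom_sum₂_mul (t - 1) t n
  linear_combination this

/-- This is the gap recursion of the sparse weight with a common factor `t` removed. In the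
induction, `h1` splits off the top term and takes a factor `1 + t` from the others. -/
theorem one_add_pow_eq {R : Type*} [CommRing R] (t : R) (p : ℕ) :
    (1 + t) ^ p = ∑ j ∈ Finset.range (p + 1), t ^ j +
      t * ∑ i ∈ Finset.range p, (∑ j ∈ Finset.range i, t ^ j) * (1 + t) ^ (p - 1 - i) := by
  induction p with
  | zero => simp
  | succ p ih =>
    have h1 : ∑ i ∈ Finset.range (p + 1),
        (∑ j ∈ Finset.range i, t ^ j) * (1 + t) ^ (p + 1 - 1 - i) =
        (1 + t) * ∑ i ∈ Finset.range p, (∑ j ∈ Finset.range i, t ^ j) * (1 + t) ^ (p - 1 - i) +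
          ∑ j ∈ Finset.range p, t ^ j := by
      rw [Finset.sum_range_succ, Finset.mul_sum]
      congr 1
      · refine Finset.sum_congr rfl fun i hi => ?_
        rw [Finset.mem_range] at hi
        rw [show p + 1 - 1 - i = p - 1 - i + 1 by omega, pow_succ]
        ring
      · simp
    rw [h1, pow_succ]
    simp only [Finset.sum_range_succ] at ih ⊢
    linear_combination (1 + t) * ih

theorem card_eq_card_shiftDown_add_one {S : Finset ℕ} {m : ℕ} (hm : m ∈ S)
    (hmin : ∀ j ∈ S, m ≤ j) : S.card = (shiftDown m S).card + 1 := by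
  have h : S.erase m = (shiftDown m S).image (m + ·) := by
    ext j
    simp only [Finset.mem_erase, Finset.mem_image, mem_shiftDown]
    constructor
    · rintro ⟨h1, h2⟩
      have := hmin j h2
      exact ⟨j - m, ⟨by omega, by rwa [Nat.add_sub_cancel' this]⟩, by omega⟩
    · rintro ⟨i, ⟨h1, h2⟩, rfl⟩
      exact ⟨by omega, h2⟩
  rw [← Finset.card_erase_add_one hm, h, Finset.card_image_of_injective _ (add_right_injective m)]

theorem noTwoConsecutive_iff_shiftDown {S : Finset ℕ} {m : ℕ} (hm : m ∈ S)
    (hmin : ∀ j ∈ S, m ≤ j) :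
    NoTwoConsecutive S ↔ NoTwoConsecutive (shiftDown m S) ∧ 1 ∉ shiftDown m S := by
  constructor
  · intro h
    refine ⟨fun j hj hj' => ?_, fun h' => ?_⟩
    · exact h _ (mem_shiftDown.1 hj).2 (mem_shiftDown.1 hj').2
    · exact h m hm (mem_shiftDown.1 h').2
  · rintro ⟨h, h'⟩ j hj hj'
    rcases (hmin j hj).eq_or_lt with rfl | hmj
    · exact h' (mem_shiftDown.2 ⟨le_rfl, hj'⟩)
    · refine h (j - m) (mem_shiftDown.2 ⟨by omega, ?_⟩) (mem_shiftDown.2 ⟨by omega, ?_⟩)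
      · rwa [Nat.add_sub_cancel' hmj.le]
      · rwa [← add_assoc, Nat.add_sub_cancel' hmj.le]

/-- `S` and its translate by one are disjoint subsets of [2, n+1], which has `n` elements when `n ≥
1`. -/
theorem two_mul_card_le {S : Finset ℕ} {n : ℕ} (hS : S ⊆ Finset.Icc 2 n)
    (h : NoTwoConsecutive S) : 2 * S.card ≤ n := by
  rcases Nat.lt_or_ge n 2 with hn | hn
  · rw [Finset.Icc_eq_empty (by omega), Finset.subset_empty] at hS
    simp [hS]
  have hd : Disjoint S (S.image (· + 1)) := by
    rw [Finset.disjoint_left]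
    intro a ha ha'
    obtain ⟨b, hb, rfl⟩ := Finset.mem_image.1 ha'
    exact h b hb ha
  have hsub : S ∪ S.image (· + 1) ⊆ Finset.Icc 2 (n + 1) := by
    intro a ha
    rw [Finset.mem_union, Finset.mem_image] at ha
    rcases ha with ha | ⟨b, hb, rfl⟩
    · have := Finset.mem_Icc.1 (hS ha)
      rw [Finset.mem_Icc]; omega
    · have := Finset.mem_Icc.1 (hS hb)
      rw [Finset.mem_Icc]; omega
  have := Finset.card_le_card hsub
  rw [Finset.card_union_of_disjoint hd,
    Finset.card_image_of_injective _ (add_left_injective 1), Nat.card_Icc] at this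
  omega

theorem subset_Icc_two {S : Finset ℕ} {n : ℕ} (hS : S ⊆ Finset.Icc 1 n) :
    S ⊆ Finset.Icc 2 n ↔ 1 ∉ S := by
  constructor
  · intro h h1
    have := Finset.mem_Icc.1 (h h1)
    omega
  · intro h j hj
    have := Finset.mem_Icc.1 (hS hj)
    have : j ≠ 1 := fun h' => h (h' ▸ hj)
    rw [Finset.mem_Icc]; omega

theorem subset_Icc_pred {S : Finset ℕ} {a n : ℕ} (hn : 1 ≤ n) :
    S ⊆ Finset.Icc a (n - 1) ↔ S ⊆ Finset.Icc a n ∧ n ∉ S := by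
  constructor
  · intro h
    refine ⟨h.trans (Finset.Icc_subset_Icc_right (by omega)), fun hS => ?_⟩
    have := Finset.mem_Icc.1 (h hS)
    omega
  · rintro ⟨h, h'⟩ j hj
    have := Finset.mem_Icc.1 (h hj)
    have : j ≠ n := fun hjn => h' (hjn ▸ hj)
    rw [Finset.mem_Icc]; omega

theorem Icc_one_eq_Ico (n : ℕ) : Finset.Icc 1 n = Finset.Ico 1 (n + 1) := by
  ext; simp only [Finset.mem_Icc, Finset.mem_Ico]; omega

/-! ### The two weights as gap products -/

section Weights

open Classical in
/-- The contribution of a colored permutation of `[n]` with ascent set `S` to the colored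
derangement polynomial. -/
noncomputable def sparseWeight {R : Type*} [CommSemiring R] (t : R) (n : ℕ) (S : Finset ℕ) : R :=
  if n = 0 then 1
  else if NoTwoConsecutive S ∧ 1 ∉ S then
    if n ∈ S then t ^ S.card * (1 + t) ^ (n - 2 * S.card)
    else t ^ (S.card + 1) * (1 + t) ^ (n - 1 - 2 * S.card)
  else 0

theorem map_sparseWeight {R R' : Type*} [CommSemiring R] [CommSemiring R'] (φ : R →+* R') (t : R)
    (n : ℕ) (S : Finset ℕ) : φ (sparseWeight t n S) = sparseWeight (φ t) n S := by
  unfold sparseWeight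
  split_ifs <;> simp

variable {R : Type*} [CommRing R]

/-- A gap of length `m` consists of `m - 1` descents and the ascent closing it; the final gap has
only descents. -/
theorem isGapProduct_pow (t : R) :
    IsGapProduct (fun n S => t ^ (n - S.card)) (fun m => t ^ (m - 1)) (fun n => t ^ n) where
  empty n := by simp
  min n S hS m hm hmin := by
    have h1 := card_eq_card_shiftDown_add_one hm hmin
    have h2 := Finset.mem_Icc.1 (hS hm)
    have h3 := Finset.card_le_card (shiftDown_subset (k := m) hS)
    rw [Nat.card_Icc] at h3
    rw [← pow_add]
    congr 1
    omega

theorem sum_eulerian_weight (t : R) (n r : ℕ) :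
    ∑ w : ColoredPerm n r, t ^ (n - (Asc w).card) = (t - 1) ^ n * ((r - 1 : ℕ) : R) ^ n +
      ∑ k ∈ Finset.Icc 1 n, n.choose k * ((t - 1) ^ (k - 1) * r ^ k) *
        ∑ v : ColoredPerm (n - k) r, t ^ (n - k - (Asc v).card) := by
  refine (isGapProduct_pow t).sum_eq (a := fun k => (t - 1) ^ (k - 1)) (b := fun n => (t - 1) ^ n)
    (fun m hm => ?_) (fun n => ?_) n r
  · obtain ⟨m, rfl⟩ := Nat.exists_eq_add_of_le' hm
    rw [Finset.sum_Ico_eq_sum_range]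
    simp only [Nat.add_sub_cancel, Nat.add_sub_cancel_left]
    rw [geom_gap R t m]
    congr 1
    refine Finset.sum_congr rfl fun i hi => ?_
    congr 2
    omega
  · rw [Icc_one_eq_Ico, Finset.sum_Ico_eq_sum_range]
    simp only [Nat.add_sub_cancel, Nat.add_sub_cancel_left]
    rw [geom_gap R t n]
    congr 1
    refine Finset.sum_congr rfl fun i hi => ?_
    congr 2
    omega

/-- A gap of length one means that 1 is an ascent or that two ascents are consecutive, hence weight
zero. An empty final gap means `n ∈ S`, hence the value 1 at `n = 0`. -/
theorem isGapProduct_sparseWeight (t : R) :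
    IsGapProduct (sparseWeight t) (fun m => if m ≤ 1 then 0 else t * (1 + t) ^ (m - 2))
      (fun n => if n = 0 then 1 else t * (1 + t) ^ (n - 1)) where
  empty n := by
    simp [sparseWeight, NoTwoConsecutive]
  min n S hS m hm hmin := by
    have hmn := Finset.mem_Icc.1 (hS hm)
    have hc := card_eq_card_shiftDown_add_one hm hmin
    have hT := shiftDown_subset (k := m) hS
    have hn : n ≠ 0 := by omega
    rcases Nat.lt_or_ge m 2 with h2 | h2
    · obtain rfl : m = 1 := by omega
      simp [sparseWeight, hn, hm]
    have h1 : 1 ∉ S := fun h => by have := hmin 1 h; omega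
    have hm1 : ¬ m ≤ 1 := by omega
    rcases hmn.2.eq_or_lt with rfl | hlt
    · obtain rfl : S = {m} := by
        ext j
        rw [Finset.mem_singleton]
        constructor
        · intro hj
          exact le_antisymm (Finset.mem_Icc.1 (hS hj)).2 (hmin j hj)
        · rintro rfl; exact hm
      have : m ≠ 1 := by omega
      simp [sparseWeight, NoTwoConsecutive, hn, hm1, this.symm]
    · have hsp := noTwoConsecutive_iff_shiftDown hm hmin
      have hnS : n ∈ S ↔ n - m ∈ shiftDown m S := by
        rw [mem_shiftDown, Nat.add_sub_cancel' hlt.le, and_iff_right (by omega)]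
      have hnm : n - m ≠ 0 := by omega
      simp only [sparseWeight, if_neg hn, if_neg hnm, if_neg hm1, hnS, hc]
      by_cases hs : NoTwoConsecutive (shiftDown m S) ∧ 1 ∉ shiftDown m S
      · have hT2 := (subset_Icc_two hT).2 hs.2
        rw [if_pos ⟨hsp.2 hs, h1⟩, if_pos hs]
        split_ifs with hmem
        · have hle := two_mul_card_le hT2 hs.1
          rw [show n - 2 * ((shiftDown m S).card + 1) =
            (m - 2) + (n - m - 2 * (shiftDown m S).card) by omega, pow_add, pow_succ]
          ring
        · have hle := two_mul_card_le ((subset_Icc_pred (by omega)).2 ⟨hT2, hmem⟩) hs.1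
          rw [show n - 1 - 2 * ((shiftDown m S).card + 1) =
            (m - 2) + (n - m - 1 - 2 * (shiftDown m S).card) by omega, pow_add, pow_succ]
          ring
      · rw [if_neg fun h => hs (hsp.1 h.1), if_neg hs, mul_zero]

theorem sparse_gap_recursion (t : R) (p : ℕ) :
    t * (1 + t) ^ p = t * ∑ j ∈ Finset.range (p + 1), t ^ j +
      ∑ i ∈ Finset.range p, (t * ∑ j ∈ Finset.range i, t ^ j) * (t * (1 + t) ^ (p - 1 - i)) := by
  have : ∑ i ∈ Finset.range p, (t * ∑ j ∈ Finset.range i, t ^ j) * (t * (1 + t) ^ (p - 1 - i)) =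
      t * (t * ∑ i ∈ Finset.range p, (∑ j ∈ Finset.range i, t ^ j) * (1 + t) ^ (p - 1 - i)) := by
    rw [Finset.mul_sum, Finset.mul_sum]
    exact Finset.sum_congr rfl fun i _ => by ring
  rw [this, one_add_pow_eq t p]
  ring

theorem sum_sparseWeight (t : R) (n r : ℕ) :
    ∑ w : ColoredPerm n r, sparseWeight t n (Asc w) = t ^ n * ((r - 1 : ℕ) : R) ^ n +
      ∑ k ∈ Finset.Icc 1 n, n.choose k * ((t * ∑ j ∈ Finset.range (k - 1), t ^ j) * r ^ k) *
        ∑ v : ColoredPerm (n - k) r, sparseWeight t (n - k) (Asc v) := by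
  refine (isGapProduct_sparseWeight t).sum_eq (a := fun k => t * ∑ j ∈ Finset.range (k - 1), t ^ j)
    (b := fun n => t ^ n) (fun m hm => ?_) (fun n => ?_) n r
  · rcases hm.eq_or_lt with rfl | hm
    · simp
    obtain ⟨p, rfl⟩ := Nat.exists_eq_add_of_le' (show 2 ≤ m from hm)
    rw [Finset.sum_Ico_eq_sum_range, if_neg (by omega), Nat.add_sub_cancel,
      sparse_gap_recursion, show p + 2 - 1 = p + 1 by omega,
      Finset.sum_range_succ (fun k => _ * ite _ _ _) p]
    -- The top term carries the weight of a gap of length one, which is zero.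
    rw [if_pos (by omega), mul_zero, add_zero]
    congr 1
    refine Finset.sum_congr rfl fun i hi => ?_
    rw [Finset.mem_range] at hi
    rw [if_neg (by omega), Nat.add_sub_cancel_left, show p + 2 - (1 + i) - 2 = p - 1 - i by omega]
  · rcases n with _ | p
    · simp
    rw [Icc_one_eq_Ico, Finset.sum_Ico_eq_sum_range, if_neg (by omega), Nat.add_sub_cancel,
      sparse_gap_recursion, Nat.add_sub_cancel, Finset.sum_range_succ (fun k => _ * ite _ _ _) p]
    have : ∀ i ∈ Finset.range p, (t * ∑ j ∈ Finset.range (1 + i - 1), t ^ j) *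
        (if p + 1 - (1 + i) = 0 then 1 else t * (1 + t) ^ (p + 1 - (1 + i) - 1)) =
        (t * ∑ j ∈ Finset.range i, t ^ j) * (t * (1 + t) ^ (p - 1 - i)) := fun i hi => by
      rw [Finset.mem_range] at hi
      rw [if_neg (by omega), Nat.add_sub_cancel_left,
        show p + 1 - (1 + i) - 1 = p - 1 - i by omega]
    -- The top term, with empty remainder, is t + ⋯ + t^p; the term t^(p+1) from `b` completes the
    -- geometric sum.
    rw [Finset.sum_congr rfl this, if_pos (by omega), Nat.add_sub_cancel_left,
      Finset.sum_range_succ (fun j => t ^ j) p]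
    ring

end Weights

/-! ### Exponential generating functions -/

section GeneratingFunctions

variable {R : Type*} [CommRing R] [Algebra ℚ R]

/-- The exponential generating function of a sequence. -/
noncomputable def egf (u : ℕ → R) : PowerSeries R :=
  PowerSeries.mk fun n => algebraMap ℚ R (1 / (n.factorial : ℚ)) * u n

theorem egf_injective : Function.Injective (egf : (ℕ → R) → PowerSeries R) := by
  intro u v h
  funext n
  have h1 := congrArg (PowerSeries.coeff n) h
  simp only [egf, PowerSeries.coeff_mk] at h1
  have h2 : IsUnit (algebraMap ℚ R (1 / (n.factorial : ℚ))) :=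
    IsUnit.map _ (IsUnit.mk0 _ (by positivity))
  exact h2.mul_left_cancel h1

theorem egf_add (u v : ℕ → R) : egf (fun n => u n + v n) = egf u + egf v := by
  ext n; simp [egf, mul_add]

theorem C_mul_egf (c : R) (u : ℕ → R) :
    PowerSeries.C c * egf u = egf (fun n => c * u n) := by
  ext n; simp [egf, mul_left_comm]

theorem egf_mul (u v : ℕ → R) : egf u * egf v =
    egf fun n => ∑ k ∈ Finset.range (n + 1), n.choose k * u k * v (n - k) := by
  ext n
  rw [PowerSeries.coeff_mul, Finset.Nat.sum_antidiagonal_eq_sum_range_succ_mk]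
  simp only [egf, PowerSeries.coeff_mk, Finset.mul_sum]
  refine Finset.sum_congr rfl fun k hk => ?_
  have hk : k ≤ n := Nat.lt_succ_iff.1 (Finset.mem_range.1 hk)
  have h : (1 / (k.factorial : ℚ)) * (1 / ((n - k).factorial : ℚ)) =
      1 / (n.factorial : ℚ) * (n.choose k : ℚ) := by
    rw [Nat.cast_choose ℚ hk]
    have : (n.factorial : ℚ) ≠ 0 := by positivity
    field_simp
  have h' := congrArg (algebraMap ℚ R) h
  simp only [map_mul, map_natCast] at h'
  linear_combination (u k * v (n - k)) * h'

theorem egf_pow (c : R) : egf (fun n => c ^ n) = PowerSeries.rescale c (PowerSeries.exp R) := by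
  ext n; simp [egf, PowerSeries.coeff_rescale, PowerSeries.coeff_exp, mul_comm]

theorem egf_pow_mul_egf_pow (c d : R) :
    egf (fun n => c ^ n) * egf (fun n => d ^ n) = egf (fun n => (c + d) ^ n) := by
  simp only [egf_pow, PowerSeries.exp_mul_exp_eq_exp_add]

theorem egf_eq_of_recursion {E a b : ℕ → R} (ha : a 0 = 0)
    (h : ∀ n, E n = b n + ∑ k ∈ Finset.Icc 1 n, n.choose k * a k * E (n - k)) :
    egf E = egf b + egf a * egf E := by
  rw [egf_mul, ← egf_add]
  congr 1
  funext n
  rw [h n, Finset.range_eq_Ico, Finset.sum_eq_sum_Ico_succ_bot (Nat.succ_pos n), ha,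
    ← Icc_one_eq_Ico]
  simp

theorem egf_zero_pow : egf (fun n => (0 : R) ^ n) = 1 := by
  ext n
  rcases n with _ | n <;> simp [egf, PowerSeries.coeff_one]

end GeneratingFunctions

/-- The binomial transform of the colored derangement weights gives the Eulerian weights. -/
theorem sum_eulerian_weight_eq {R : Type*} [CommRing R] [IsDomain R] [Algebra ℚ R] {t : R}
    (ht : t ≠ 1) (n : ℕ) {r : ℕ} (hr : 1 ≤ r) :
    ∑ w : ColoredPerm n r, t ^ (n - (Asc w).card) =
      ∑ k ∈ Finset.range (n + 1), n.choose k *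
        ∑ v : ColoredPerm k r, sparseWeight t k (Asc v) := by
  have ht' : t - 1 ≠ 0 := sub_ne_zero.2 ht
  have hr' : ((r - 1 : ℕ) : R) = r - 1 := by rw [Nat.cast_sub hr, Nat.cast_one]
  set A : ℕ → R := fun n => ∑ w : ColoredPerm n r, t ^ (n - (Asc w).card) with hA
  set D : ℕ → R := fun n => ∑ w : ColoredPerm n r, sparseWeight t n (Asc w) with hD
  let e : R → PowerSeries R := fun c => egf fun n => c ^ n
  have he : ∀ c d, e c * e d = e (c + d) := egf_pow_mul_egf_pow
  let a : ℕ → R := fun k => if k = 0 then 0 else (t - 1) ^ (k - 1) * r ^ k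
  let a' : ℕ → R := fun k => if k = 0 then 0 else (t * ∑ j ∈ Finset.range (k - 1), t ^ j) * r ^ k
  have h1 : egf A = e ((t - 1) * (r - 1)) + egf a * egf A := by
    refine egf_eq_of_recursion (if_pos rfl) fun n => ?_
    rw [hA]
    simp only
    rw [sum_eulerian_weight, hr', mul_pow]
    congr 1
    refine Finset.sum_congr rfl fun k hk => ?_
    have : k ≠ 0 := by have := (Finset.mem_Icc.1 hk).1; omega
    simp only [a, if_neg this]
  have h2 : egf D = e (t * (r - 1)) + egf a' * egf D := by
    refine egf_eq_of_recursion (if_pos rfl) fun n => ?_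
    rw [hD]
    simp only
    rw [sum_sparseWeight, hr', mul_pow]
    congr 1
    refine Finset.sum_congr rfl fun k hk => ?_
    have : k ≠ 0 := by have := (Finset.mem_Icc.1 hk).1; omega
    simp only [a', if_neg this]
  -- For k ≥ 1, (t−1)·a_k = ((t−1)r)^k; the summand 1 supplies the missing constant term.
  have ha : PowerSeries.C (t - 1) * egf a + 1 = e ((t - 1) * r) := by
    rw [C_mul_egf, ← egf_zero_pow, ← egf_add]
    refine congrArg egf (funext fun k => ?_)
    rcases k with _ | k
    · simp [a]
    · simp only [a, if_neg (Nat.succ_ne_zero k), Nat.add_sub_cancel]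
      rw [mul_pow]
      ring
  -- For k ≥ 1, (t−1)·a'_k = (t^k − t)·r^k; the bare constants correct the case k = 0.
  have ha' : PowerSeries.C (t - 1) * egf a' + PowerSeries.C t * e r + 1 =
      e (t * r) + PowerSeries.C t := by
    rw [← mul_one (PowerSeries.C t), ← egf_zero_pow (R := R)]
    simp only [e]
    rw [mul_assoc, egf_zero_pow, one_mul, ← egf_zero_pow (R := R), C_mul_egf, C_mul_egf, C_mul_egf,
      ← egf_add, ← egf_add, ← egf_add]
    refine congrArg egf (funext fun k => ?_)
    rcases k with _ | k
    · simp [a', add_comm]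
    · have := mul_geom_sum t k
      simp only [a', if_neg (Nat.succ_ne_zero k), Nat.add_sub_cancel]
      have h3 : (0 : R) ^ (k + 1) = 0 := by simp
      rw [h3, mul_pow]
      linear_combination t * r ^ (k + 1) * this
  have h3 : egf A * (PowerSeries.C t - e ((t - 1) * r)) =
      PowerSeries.C (t - 1) * e ((t - 1) * (r - 1)) := by
    have : PowerSeries.C t = PowerSeries.C (t - 1) + (1 : PowerSeries R) := by simp
    rw [this]
    linear_combination PowerSeries.C (t - 1) * h1 + egf A * ha
  have h4 : egf D * (PowerSeries.C t * e r - e (t * r)) =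
      PowerSeries.C (t - 1) * e (t * (r - 1)) := by
    have : PowerSeries.C t = PowerSeries.C (t - 1) + (1 : PowerSeries R) := by simp
    linear_combination PowerSeries.C (t - 1) * h2 + egf D * ha' + egf D * this
  -- The multiplier e(1)·e(−r) works because t(r−1) + 1 − r = (t−1)(r−1).
  have h5 : (egf D * e 1) * (PowerSeries.C t - e ((t - 1) * r)) =
      PowerSeries.C (t - 1) * e ((t - 1) * (r - 1)) := by
    have e1 : e r * e (-r) = 1 := by
      rw [he, add_neg_cancel]; exact egf_zero_pow
    have e2 : e (t * r) * e (-r) = e ((t - 1) * r) := by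
      rw [he]; congr 1; ring
    have e3 : e (t * (r - 1)) * (e 1 * e (-r)) = e ((t - 1) * (r - 1)) := by
      rw [he, he]; congr 1; ring
    linear_combination (e 1 * e (-r)) * h4 - (egf D * e 1 * PowerSeries.C t) * e1 +
      (egf D * e 1) * e2 + PowerSeries.C (t - 1) * e3
  have hne : PowerSeries.C t - e ((t - 1) * r) ≠ 0 := by
    intro h
    have := congrArg (PowerSeries.coeff 0) h
    rw [map_sub, PowerSeries.coeff_C, if_pos rfl] at this
    simp only [e, egf, PowerSeries.coeff_mk] at this
    exact ht' (by simpa using this)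
  have h6 : egf A = egf D * e 1 := mul_right_cancel₀ hne (h3.trans h5.symm)
  simp only [e] at h6
  rw [egf_mul] at h6
  have := congrFun (egf_injective h6) n
  simpa [hA] using this

/-! ### The polynomial decomposition -/

theorem sum_card_fiber {α : Type*} [Fintype α] {M : Type*} [CommSemiring M] (Q : α → Prop)
    [DecidablePred Q] (g : α → ℕ) (I : Finset ℕ) (hI : ∀ a, Q a → g a ∈ I) (c : ℕ → M) :
    ∑ i ∈ I, (Nat.card {a // Q a ∧ g a = i} : M) * c i = ∑ a, if Q a then c (g a) else 0 := by
  classical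
  have h1 : ∀ i, (Nat.card {a // Q a ∧ g a = i} : M) * c i =
      ∑ a, if Q a ∧ g a = i then c i else 0 := by
    intro i
    rw [Nat.card_eq_fintype_card, Fintype.card_subtype, Finset.card_filter, Nat.cast_sum,
      Finset.sum_mul]
    refine Finset.sum_congr rfl fun a _ => ?_
    split_ifs <;> simp
  simp only [h1]
  rw [Finset.sum_comm]
  refine Finset.sum_congr rfl fun a _ => ?_
  split_ifs with h
  · simp only [h, true_and]
    rw [Finset.sum_ite_eq, if_pos (hI a h)]
  · simp [h]

open Classical in
theorem derangementPlus_eq_sum {n r : ℕ} (hn : n ≠ 0) :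
    derangementPlus n r = ∑ w : ColoredPerm n r,
      if Asc w ⊆ Finset.Icc 2 n ∧ NoTwoConsecutive (Asc w) ∧ n ∈ Asc w then
        X ^ (Asc w).card * (1 + X) ^ (n - 2 * (Asc w).card) else 0 := by
  rw [derangementPlus, if_neg hn, ← sum_card_fiber
    (fun w => Asc w ⊆ Finset.Icc 2 n ∧ NoTwoConsecutive (Asc w) ∧ n ∈ Asc w)
    (fun w => (Asc w).card) (Finset.Icc 1 (n / 2))
    (fun w h => ?_) (fun i => (X : ℕ[X]) ^ i * (1 + X) ^ (n - 2 * i))]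
  · refine Finset.sum_congr rfl fun i _ => ?_
    rw [xiPlus, if_neg hn, mul_assoc]
    congr 2
    exact Nat.card_congr (Equiv.subtypeEquivRight fun w => by tauto)
  · have h1 := two_mul_card_le h.1 h.2.1
    have h2 := Finset.card_pos.2 ⟨n, h.2.2⟩
    rw [Finset.mem_Icc]
    omega

open Classical in
theorem derangementMinus_eq_sum {n r : ℕ} (hn : n ≠ 0) :
    derangementMinus n r = ∑ w : ColoredPerm n r,
      if Asc w ⊆ Finset.Icc 2 (n - 1) ∧ NoTwoConsecutive (Asc w) then
        X ^ ((Asc w).card + 1) * (1 + X) ^ (n + 1 - 2 * ((Asc w).card + 1)) else 0 := by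
  rw [derangementMinus, if_neg hn, ← sum_card_fiber
    (fun w => Asc w ⊆ Finset.Icc 2 (n - 1) ∧ NoTwoConsecutive (Asc w)) (fun w => (Asc w).card + 1)
    (Finset.Icc 1 ((n + 1) / 2)) (fun w h => ?_)
    (fun i => (X : ℕ[X]) ^ i * (1 + X) ^ (n + 1 - 2 * i))]
  · refine Finset.sum_congr rfl fun i _ => ?_
    rw [xiMinus, if_neg hn, mul_assoc]
    congr 2
    exact Nat.card_congr (Equiv.subtypeEquivRight fun w => by tauto)
  · have h1 := two_mul_card_le h.1 h.2
    rw [Finset.mem_Icc]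
    omega

/-- For `n ≥ 1` the two parts are the complementary cases `n ∈ Asc w` and `n ∉ Asc w` of one weight.
-/
theorem derangementPlus_add_derangementMinus (n r : ℕ) :
    derangementPlus n r + derangementMinus n r =
      ∑ w : ColoredPerm n r, sparseWeight X n (Asc w) := by
  classical
  rcases eq_or_ne n 0 with rfl | hn
  · simp [derangementPlus, derangementMinus, sparseWeight]
  rw [derangementPlus_eq_sum hn, derangementMinus_eq_sum hn, ← Finset.sum_add_distrib]
  refine Finset.sum_congr rfl fun w _ => ?_
  simp only [subset_Icc_pred (Nat.one_le_iff_ne_zero.2 hn), subset_Icc_two (Asc_subset w),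
    sparseWeight, if_neg hn,
    show n + 1 - 2 * ((Asc w).card + 1) = n - 1 - 2 * (Asc w).card by omega]
  by_cases h1 : 1 ∈ Asc w <;> by_cases h2 : NoTwoConsecutive (Asc w) <;>
    by_cases h3 : n ∈ Asc w <;> simp [h1, h2, h3]

theorem eulerian_eq_sum_choose (n : ℕ) {r : ℕ} (hr : 1 ≤ r) :
    eulerian n r = ∑ k ∈ Finset.range (n + 1), (n.choose k : ℕ[X]) *
      (derangementPlus k r + derangementMinus k r) := by
  -- The generating function argument needs subtraction, cancellation and inverse factorials, so it
  -- runs in ℚ[X] at t = X.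
  apply Polynomial.map_injective (Nat.castRingHom ℚ) Nat.cast_injective
  have hX : (X : ℚ[X]) ≠ 1 := fun h => by simpa using congrArg natDegree h
  have := sum_eulerian_weight_eq hX n hr
  simp only [derangementPlus_add_derangementMinus, eulerian, card_Des, Polynomial.map_sum,
    Polynomial.map_mul, Polynomial.map_pow, Polynomial.map_X, Polynomial.map_natCast]
  rw [this]
  refine Finset.sum_congr rfl fun k _ => ?_
  congr 1
  refine Finset.sum_congr rfl fun w _ => ?_
  have h := map_sparseWeight (Polynomial.mapRingHom (Nat.castRingHom ℚ)) X k (Asc w)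
  simpa using h.symm

theorem eulerian_eq_add (n : ℕ) {r : ℕ} (hr : 1 ≤ r) :
    eulerian n r = eulerianPlus n r + eulerianMinus n r := by
  rw [eulerian_eq_sum_choose n hr, eulerianPlus, eulerianMinus, ← Finset.sum_add_distrib]
  exact Finset.sum_congr rfl fun k _ => mul_add _ _ _

theorem binomialEulerian_eq_add (n : ℕ) {r : ℕ} (hr : 1 ≤ r) :
    binomialEulerian n r = binomialEulerianPlus n r + binomialEulerianMinus n r := by
  rw [binomialEulerian, binomialEulerianPlus, binomialEulerianMinus, ← Finset.sum_add_distrib]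
  exact Finset.sum_congr rfl fun k _ => by rw [eulerian_eq_add k hr, mul_add]

/-! ### Expansions in the shifted bases -/

/-- Composing the two binomial transforms. -/
theorem sum_choose_pow_mul_sum_choose {R : Type*} [CommSemiring R] (t : R) (n : ℕ) (d : ℕ → R) :
    ∑ m ∈ Finset.range (n + 1), (n.choose m : R) * t ^ (n - m) *
      ∑ k ∈ Finset.range (m + 1), (m.choose k : R) * d k =
    ∑ k ∈ Finset.range (n + 1), (n.choose k : R) * d k * (1 + t) ^ (n - k) := by
  simp only [Finset.mul_sum]
  rw [Finset.sum_comm' (t' := Finset.range (n + 1)) (s' := fun k => Finset.Ico k (n + 1))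
    (fun m k => by simp only [Finset.mem_range, Finset.mem_Ico]; omega)]
  refine Finset.sum_congr rfl fun k hk => ?_
  rw [Finset.mem_range] at hk
  rw [Finset.sum_Ico_eq_sum_range, add_pow, Finset.mul_sum,
    show n + 1 - k = n - k + 1 by omega]
  refine Finset.sum_congr rfl fun j _ => ?_
  have h := congrArg (Nat.cast : ℕ → R)
    (Nat.choose_mul (n := n) (k := k + j) (s := k) (Nat.le_add_right k j))
  rw [Nat.add_sub_cancel_left, Nat.cast_mul, Nat.cast_mul] at h
  calc (n.choose (k + j) : R) * t ^ (n - (k + j)) * (((k + j).choose k : R) * d k)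
      = ((n.choose (k + j) : R) * ((k + j).choose k : R)) * (t ^ (n - (k + j)) * d k) := by ring
    _ = _ := by rw [h, one_pow, Nat.sub_sub]; ring

theorem sum_Icc_choose_mul {n c : ℕ} {ξ : ℕ → ℕ → ℕ}
    (hξ : ∀ k i, k + c < 2 * i → ξ k i = 0) (i : ℕ) :
    ∑ k ∈ Finset.Icc (2 * i - c) n, n.choose k * ξ k i =
      ∑ k ∈ Finset.range (n + 1), n.choose k * ξ k i := by
  refine Finset.sum_subset (fun k hk => ?_) fun k hk hk' => ?_
  · rw [Finset.mem_Icc] at hk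
    rw [Finset.mem_range]; omega
  · rw [Finset.mem_range] at hk
    rw [Finset.mem_Icc] at hk'
    rw [hξ k i (by omega), mul_zero]

/-- An expansion in the basis `t ^ i * (1 + t) ^ (n + c - 2 * i)` from expansions of the terms. -/
theorem sum_choose_mul_gamma {n c : ℕ} {ξ : ℕ → ℕ → ℕ} (d : ℕ → ℕ[X]) (I : Finset ℕ)
    (hξ : ∀ k i, k + c < 2 * i → ξ k i = 0)
    (hd : ∀ k ≤ n, d k = ∑ i ∈ I, (ξ k i : ℕ[X]) * X ^ i * (1 + X) ^ (k + c - 2 * i)) :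
    ∑ k ∈ Finset.range (n + 1), (n.choose k : ℕ[X]) * d k * (1 + X) ^ (n - k) =
      ∑ i ∈ I, ((∑ k ∈ Finset.Icc (2 * i - c) n, n.choose k * ξ k i : ℕ) : ℕ[X]) * X ^ i *
        (1 + X) ^ (n + c - 2 * i) := by
  simp only [sum_Icc_choose_mul hξ, Nat.cast_sum, Finset.sum_mul]
  rw [Finset.sum_comm]
  refine Finset.sum_congr rfl fun k hk => ?_
  rw [Finset.mem_range] at hk
  rw [hd k (by omega), Finset.mul_sum, Finset.sum_mul]
  refine Finset.sum_congr rfl fun i _ => ?_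
  -- In this case the truncated exponents need not add up, but the coefficient vanishes.
  by_cases hi : k + c < 2 * i
  · simp [hξ k i hi]
  · rw [show n + c - 2 * i = (k + c - 2 * i) + (n - k) by omega, pow_add]
    push_cast
    ring

theorem xiPlus_eq_zero {k r i : ℕ} (h : k < 2 * i) : xiPlus k r i = 0 := by
  rw [xiPlus]
  split_ifs with h1 h2
  · omega
  · rfl
  · rw [Nat.card_eq_zero]
    refine Or.inl ⟨fun w => ?_⟩
    have := two_mul_card_le w.2.1 w.2.2.2.1
    omega

theorem xiMinus_eq_zero {k r i : ℕ} (h : k + 1 < 2 * i) : xiMinus k r i = 0 := by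
  rw [xiMinus]
  split_ifs with h1
  · rfl
  · rw [Nat.card_eq_zero]
    refine Or.inl ⟨fun w => ?_⟩
    have := two_mul_card_le w.2.1 w.2.2.2
    omega

theorem xiPlus_zero_right {k r : ℕ} (hk : k ≠ 0) : xiPlus k r 0 = 0 := by
  rw [xiPlus, if_neg hk, Nat.card_eq_zero]
  refine Or.inl ⟨fun w => ?_⟩
  have h1 := w.2.2.2.2
  rw [Finset.card_eq_zero.1 w.2.2.1] at h1
  simp at h1

theorem binomialEulerianPlus_eq (n r : ℕ) : binomialEulerianPlus n r =
    ∑ i ∈ Finset.range (n / 2 + 1),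
      (gammaPlus n r i : ℕ[X]) * X ^ i * (1 + X) ^ (n - 2 * i) := by
  simp only [binomialEulerianPlus, eulerianPlus]
  rw [sum_choose_pow_mul_sum_choose, sum_choose_mul_gamma (c := 0) (ξ := fun k i => xiPlus k r i)
    (fun k => derangementPlus k r) (Finset.range (n / 2 + 1)) (fun k i h => xiPlus_eq_zero h)]
  · rfl
  · intro k hk
    -- The index `i = 0` is needed only for `k = 0`; for `k ≠ 0` its coefficient is zero because `k`
    -- must be an ascent.
    rw [derangementPlus]
    split_ifs with h
    · subst h
      rw [Finset.sum_eq_single 0]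
      · simp [xiPlus]
      · intro i _ hi; simp [xiPlus, hi]
      · simp
    · refine Finset.sum_subset (fun i hi => ?_) fun i hi hi' => ?_
      · rw [Finset.mem_Icc] at hi
        rw [Finset.mem_range]; omega
      · rw [Finset.mem_Icc] at hi'
        rcases Nat.eq_zero_or_pos i with rfl | h0
        · simp [xiPlus_zero_right h]
        · simp [xiPlus_eq_zero (show k < 2 * i by omega)]

theorem binomialEulerianMinus_eq (n r : ℕ) : binomialEulerianMinus n r =
    ∑ i ∈ Finset.Icc 1 ((n + 1) / 2),
      (gammaMinus n r i : ℕ[X]) * X ^ i * (1 + X) ^ (n + 1 - 2 * i) := by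
  simp only [binomialEulerianMinus, eulerianMinus]
  rw [sum_choose_pow_mul_sum_choose, sum_choose_mul_gamma (c := 1) (ξ := fun k i => xiMinus k r i)
    (fun k => derangementMinus k r) (Finset.Icc 1 ((n + 1) / 2)) (fun k i h => xiMinus_eq_zero h)]
  · rfl
  · intro k hk
    rw [derangementMinus]
    split_ifs with h
    · subst h
      simp [xiMinus]
    · refine Finset.sum_subset (Finset.Icc_subset_Icc_right (by omega)) fun i hi hi' => ?_
      rw [Finset.mem_Icc] at hi hi'
      simp [xiMinus_eq_zero (show k + 1 < 2 * i by omega)]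

/-! ### Counting words that start decreasing to one -/

/-- The first `m` letters are `w(1) > ⋯ > w(m) = 1`, all of color zero. -/
def StartsDecreasingToOneAt {n r : ℕ} (m : ℕ) (w : ColoredPerm n r) : Prop :=
  (∀ k ∈ Finset.Icc 1 m, color w k = 0) ∧
    (∀ k, 1 ≤ k → k < m → value w (k + 1) < value w k) ∧ value w m = 1

theorem value_pos {n r : ℕ} (w : ColoredPerm n r) {k : ℕ} (hk : 1 ≤ k) : 1 ≤ value w k := by
  unfold value
  split_ifs <;> omega

theorem StartsDecreasingToOneAt.le {n r m : ℕ} {w : ColoredPerm n r}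
    (h : StartsDecreasingToOneAt m w) {j : ℕ} (hj : j ∈ Asc w) : m ≤ j := by
  by_contra hc
  obtain ⟨⟨h1, h2⟩, h3⟩ := mem_Asc.1 hj
  refine h3 (Or.inr ⟨?_, h.2.1 j h1 (by omega)⟩)
  rw [h.1 j (Finset.mem_Icc.2 (by omega)), h.1 (j + 1) (Finset.mem_Icc.2 (by omega))]

theorem StartsDecreasingToOneAt.mem_Asc {n r m : ℕ} {w : ColoredPerm n r}
    (h : StartsDecreasingToOneAt m w) (h1 : 1 ≤ m) (hm : m ≤ n) : m ∈ Asc w := by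
  rw [ColoredEulerian.mem_Asc, h.1 m (Finset.mem_Icc.2 ⟨h1, le_rfl⟩), h.2.2]
  have := value_pos w (Nat.le_add_left 1 m)
  omega

/-- In either case the position is the first ascent of `w`. -/
theorem StartsDecreasingToOneAt.unique {n r m m' : ℕ} {w : ColoredPerm n r}
    (h : StartsDecreasingToOneAt m w) (h' : StartsDecreasingToOneAt m' w)
    (hm : m ∈ Finset.Icc 1 n) (hm' : m' ∈ Finset.Icc 1 n) : m = m' := by
  rw [Finset.mem_Icc] at hm hm'
  exact le_antisymm (h.le (h'.mem_Asc hm'.1 hm'.2)) (h'.le (h.mem_Asc hm.1 hm.2))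

/-- Here `z` is the stored form of the value 1. If it occurs in a decreasing zero-colored block, it
must come last, since no smaller value can follow it. -/
theorem startsDecreasingToOneAt_glue {m l r : ℕ} (hm : 1 ≤ m) {z : Fin (m + l)} (hz : (z : ℕ) = 0)
    (A : {A : Finset (Fin (m + l)) // A.card = m}) (u : ColoredPerm m r) (v : ColoredPerm l r) :
    StartsDecreasingToOneAt m (glue A u v) ↔ z ∈ A.1 ∧
      (∀ j ∈ Asc u, m ≤ j) ∧ ∀ x, ((u.2 ∘ u.1.symm) x : ℕ) = 0 := by
  constructor
  · intro h
    refine ⟨?_, (forall_mem_Asc_glue A u v).1 fun j hj => h.le hj, fun x => ?_⟩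
    · rw [mem_iff_glue A u v]
      refine ⟨⟨m - 1, by omega⟩, ?_⟩
      have h1 := h.2.2
      obtain ⟨p, rfl⟩ := Nat.exists_eq_add_of_le' hm
      rw [value_succ _ (show p < p + 1 + l by omega)] at h1
      exact Fin.ext ((Nat.succ_injective h1).trans hz.symm)
    · have h1 := h.1 ((u.1.symm x : ℕ) + 1) (Finset.mem_Icc.2 (by omega))
      rwa [color_glue_left A u v (u.1.symm x).2, color_succ u (u.1.symm x).2] at h1
  · rintro ⟨h1, h2, h3⟩
    have hc : ∀ k ∈ Finset.Icc 1 m, color (glue A u v) k = 0 := by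
      intro k hk
      obtain ⟨k, rfl⟩ := Nat.exists_eq_add_of_le' (Finset.mem_Icc.1 hk).1
      have hkm : k < m := (Finset.mem_Icc.1 hk).2
      rw [color_glue_left A u v hkm, color_succ u hkm]
      simpa using h3 (u.1 ⟨k, hkm⟩)
    have hv : ∀ k, 1 ≤ k → k < m → value (glue A u v) (k + 1) < value (glue A u v) k := by
      intro k hk hkm
      by_contra hlt
      have := (forall_mem_Asc_glue A u v).2 h2 k (by
        rw [mem_Asc, hc k (Finset.mem_Icc.2 (by omega)), hc (k + 1) (Finset.mem_Icc.2 (by omega))]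
        omega)
      omega
    refine ⟨hc, hv, ?_⟩
    obtain ⟨i, hi⟩ := (mem_iff_glue A u v _).1 h1
    have h4 : value (glue A u v) ((i : ℕ) + 1) = 1 := by
      rw [value_succ _ (show (i : ℕ) < m + l by omega)]
      exact congrArg (· + 1) ((congrArg Fin.val hi).trans hz)
    by_cases him : (i : ℕ) + 1 < m
    · have h5 := hv _ (Nat.le_add_left 1 _) him
      have h6 := value_pos (glue A u v) (Nat.le_add_left 1 ((i : ℕ) + 1))
      omega
    · rwa [show (i : ℕ) + 1 = m by omega] at h4

theorem card_finset_mem {α : Type*} [Fintype α] [DecidableEq α] (a : α) (m : ℕ) :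
    ∑ A : {A : Finset α // A.card = m + 1}, (if a ∈ A.1 then 1 else 0) =
      (Fintype.card α - 1).choose m := by
  rw [← Finset.card_filter, ← Finset.card_univ, ← Finset.card_erase_of_mem (Finset.mem_univ a),
    ← Finset.card_powersetCard]
  refine Finset.card_bij (fun A _ => A.1.erase a) (fun A hA => ?_) (fun A hA B hB h => ?_)
    fun B hB => ?_
  · have ha := (Finset.mem_filter.1 hA).2
    rw [Finset.mem_powersetCard, Finset.card_erase_of_mem ha, A.2]
    exact ⟨Finset.erase_subset_erase _ (Finset.subset_univ _), rfl⟩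
  · have ha := (Finset.mem_filter.1 hA).2
    have hb := (Finset.mem_filter.1 hB).2
    exact Subtype.ext (by rw [← Finset.insert_erase ha, h, Finset.insert_erase hb])
  · rw [Finset.mem_powersetCard] at hB
    have haB : a ∉ B := fun h => by simpa using hB.1 h
    refine ⟨⟨insert a B, by rw [Finset.card_insert_of_notMem haB, hB.2]⟩, ?_, ?_⟩
    · simp
    · exact Finset.erase_insert haB

open Classical in
theorem card_decreasing_color_zero (m : ℕ) {r : ℕ} (hr : 1 ≤ r) :
    ∑ u : ColoredPerm m r, (if (∀ j ∈ Asc u, m ≤ j) ∧ ∀ x, ((u.2 ∘ u.1.symm) x : ℕ) = 0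
      then 1 else 0) = 1 := by
  have := sum_decreasing (k := m) (r := r) (fun c => if ∀ x, (c x : ℕ) = 0 then 1 else 0)
  simp only [← ite_and] at this
  rw [this, Finset.sum_eq_single (fun _ => ⟨0, hr⟩)]
  · simp
  · intro c _ hc
    rw [if_neg]
    exact fun h => hc (funext fun x => Fin.ext (h x))
  · simp

theorem natCard_eq_sum {α : Type*} [Fintype α] (P : α → Prop) [DecidablePred P] :
    Nat.card {a // P a} = ∑ a, if P a then 1 else 0 := by
  rw [Nat.card_eq_fintype_card, Fintype.card_subtype, Finset.card_filter]

/-- The value set of the first block must contain 1, leaving `m` of `m + l` values to choose; the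
block is then forced, and the rest is constrained only by `Q`. -/
theorem card_startsDecreasingToOneAt {m l r : ℕ} (hr : 1 ≤ r) (P Q : Finset ℕ → Prop)
    (hPQ : ∀ S ⊆ Finset.Icc 1 (m + 1 + l), m + 1 ∈ S → (∀ j ∈ S, m + 1 ≤ j) →
      (P S ↔ Q (shiftDown (m + 1) S))) :
    Nat.card {w : ColoredPerm (m + 1 + l) r // P (Asc w) ∧ StartsDecreasingToOneAt (m + 1) w} =
      (m + l).choose m * Nat.card {v : ColoredPerm l r // Q (Asc v)} := by
  classical
  obtain ⟨z, hz⟩ : ∃ z : Fin (m + 1 + l), (z : ℕ) = 0 := ⟨⟨0, by omega⟩, rfl⟩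
  rw [natCard_eq_sum, natCard_eq_sum, sum_eq_sum_glue]
  have h : ∀ (A : {A : Finset (Fin (m + 1 + l)) // A.card = m + 1}) (u : ColoredPerm (m + 1) r)
      (v : ColoredPerm l r),
      (if P (Asc (glue A u v)) ∧ StartsDecreasingToOneAt (m + 1) (glue A u v) then 1 else 0) =
      (if z ∈ A.1 then 1 else 0) *
        ((if (∀ j ∈ Asc u, m + 1 ≤ j) ∧ ∀ x, ((u.2 ∘ u.1.symm) x : ℕ) = 0 then 1 else 0) *
        if Q (Asc v) then 1 else 0) := by
    intro A u v
    have h1 : (P (Asc (glue A u v)) ∧ StartsDecreasingToOneAt (m + 1) (glue A u v)) ↔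
        (Q (Asc v) ∧ z ∈ A.1 ∧ (∀ j ∈ Asc u, m + 1 ≤ j) ∧
          ∀ x, ((u.2 ∘ u.1.symm) x : ℕ) = 0) := by
      rw [← startsDecreasingToOneAt_glue (Nat.le_add_left 1 m) hz A u v]
      refine and_congr_left fun h => ?_
      rw [hPQ _ (Asc_subset _) (h.mem_Asc (by omega) (by omega)) fun j hj => h.le hj,
        shiftDown_Asc_glue]
    split_ifs <;> first | rfl | (exfalso; tauto)
  simp only [h, ← Finset.mul_sum, ← Finset.sum_mul]
  rw [card_decreasing_color_zero _ hr, one_mul, card_finset_mem, Fintype.card_fin,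
    show m + 1 + l - 1 = m + l by omega]

theorem card_startsDecreasingToOne {n r : ℕ} (hr : 1 ≤ r) (P : Finset ℕ → Prop)
    (Q : ℕ → Finset ℕ → Prop)
    (hPQ : ∀ m l S, m + l = n → S ⊆ Finset.Icc 1 (n + 1) → m + 1 ∈ S → (∀ j ∈ S, m + 1 ≤ j) →
      (P S ↔ Q l (shiftDown (m + 1) S))) :
    Nat.card {w : ColoredPerm (n + 1) r // P (Asc w) ∧ StartsDecreasingToOne w} =
      ∑ k ∈ Finset.range (n + 1), n.choose k * Nat.card {v : ColoredPerm k r // Q k (Asc v)} := by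
  classical
  have h1 : Nat.card {w : ColoredPerm (n + 1) r // P (Asc w) ∧ StartsDecreasingToOne w} =
      ∑ m ∈ Finset.range (n + 1), Nat.card
        {w : ColoredPerm (n + 1) r // P (Asc w) ∧ StartsDecreasingToOneAt (m + 1) w} := by
    simp only [natCard_eq_sum]
    rw [Finset.sum_comm]
    refine Finset.sum_congr rfl fun w _ => ?_
    by_cases hw : P (Asc w) ∧ StartsDecreasingToOne w
    · obtain ⟨hP, m, hm, hmw⟩ := id hw
      have hmw : StartsDecreasingToOneAt m w := hmw
      obtain ⟨p, rfl⟩ := Nat.exists_eq_add_of_le' (Finset.mem_Icc.1 hm).1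
      rw [if_pos hw, Finset.sum_eq_single p, if_pos ⟨hP, hmw⟩]
      · intro q hq hqp
        rw [Finset.mem_range] at hq
        rw [if_neg]
        rintro ⟨-, h⟩
        have := h.unique hmw (Finset.mem_Icc.2 (by omega)) hm
        omega
      · intro hp
        rw [Finset.mem_Icc] at hm
        rw [Finset.mem_range] at hp
        omega
    · rw [if_neg hw, Finset.sum_eq_zero]
      intro q hq
      rw [Finset.mem_range] at hq
      rw [if_neg]
      rintro ⟨hP, h⟩
      exact hw ⟨hP, q + 1, Finset.mem_Icc.2 (by omega), h⟩
  -- Reflection replaces the block index `m` by the length `n - m` of the remaining word.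
  rw [h1, ← Finset.sum_range_reflect (fun k => n.choose k * _)]
  refine Finset.sum_congr rfl fun m hm => ?_
  obtain ⟨l, rfl⟩ := Nat.exists_eq_add_of_le (Nat.lt_succ_iff.1 (Finset.mem_range.1 hm))
  rw [show m + l + 1 - 1 - m = l by omega]
  have h2 := card_startsDecreasingToOneAt (m := m) (l := l) hr P (Q l) (fun S hS => by
    rw [show m + 1 + l = m + l + 1 by omega] at hS
    exact hPQ m l S rfl hS)
  rw [show m + 1 + l = m + l + 1 by omega] at h2
  rw [h2, Nat.choose_symm_add]

/-- The disjunct `k = 0` absorbs the convention for the empty word, which has no ascents. -/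
theorem xiPlus_eq_card (k r i : ℕ) : xiPlus k r i = Nat.card {v : ColoredPerm k r //
    (Asc v).card = i ∧ (NoTwoConsecutive (Asc v) ∧ 1 ∉ Asc v) ∧ (k = 0 ∨ k ∈ Asc v)} := by
  rw [xiPlus]
  split_ifs with h1 h2
  · subst h1 h2
    have : ∀ v : ColoredPerm 0 r, Asc v = ∅ := fun v => rfl
    simp [this, NoTwoConsecutive]
  · subst h1
    have : ∀ v : ColoredPerm 0 r, Asc v = ∅ := fun v => rfl
    simp [this, Ne.symm h2]
  · refine Nat.card_congr (Equiv.subtypeEquivRight fun v => ?_)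
    rw [subset_Icc_two (Asc_subset v)]
    tauto

theorem xiMinus_eq_card (k r i : ℕ) : xiMinus k r i = Nat.card {v : ColoredPerm k r //
    (Asc v).card + 1 = i ∧ (NoTwoConsecutive (Asc v) ∧ 1 ∉ Asc v) ∧ k ≠ 0 ∧ k ∉ Asc v} := by
  rw [xiMinus]
  split_ifs with h1
  · subst h1
    simp
  · refine Nat.card_congr (Equiv.subtypeEquivRight fun v => ?_)
    rw [subset_Icc_pred (Nat.one_le_iff_ne_zero.2 h1), subset_Icc_two (Asc_subset v)]
    tauto

/-- For `l = 0` the last position is the first ascent itself, which the shift discards. -/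
theorem succ_mem_iff_shiftDown {m l : ℕ} {S : Finset ℕ} (hm : m + 1 ∈ S) :
    m + l + 1 ∈ S ↔ l = 0 ∨ l ∈ shiftDown (m + 1) S := by
  rw [mem_shiftDown, add_right_comm]
  rcases l with _ | l
  · simpa using hm
  · simp

theorem gammaPlus_eq_card (n i : ℕ) {r : ℕ} (hr : 1 ≤ r) : gammaPlus n r i =
    Nat.card {w : ColoredPerm (n + 1) r //
      (Asc w).card = i + 1 ∧ NoTwoConsecutive (Asc w) ∧ n + 1 ∈ Asc w ∧
        StartsDecreasingToOne w} := by
  have h := card_startsDecreasingToOne (n := n) hr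
    (fun S => S.card = i + 1 ∧ NoTwoConsecutive S ∧ n + 1 ∈ S)
    (fun k S => S.card = i ∧ (NoTwoConsecutive S ∧ 1 ∉ S) ∧ (k = 0 ∨ k ∈ S))
    (fun m l S hml hS hm hmin => by
      subst hml
      rw [card_eq_card_shiftDown_add_one hm hmin, noTwoConsecutive_iff_shiftDown hm hmin,
        succ_mem_iff_shiftDown hm, Nat.add_right_cancel_iff])
  simp only [← xiPlus_eq_card] at h
  simp only [and_assoc] at h
  rw [h, gammaPlus]
  exact sum_Icc_choose_mul (c := 0) (ξ := fun k i => xiPlus k r i)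
    (fun k i h => xiPlus_eq_zero h) i

/-- The discarded first ascent accounts for the `+ 1` in the cardinality. Excluding `n + 1` from the
ascents rules out an empty remainder, in accordance with the zero convention at `k = 0`. -/
theorem gammaMinus_eq_card (n i : ℕ) {r : ℕ} (hr : 1 ≤ r) : gammaMinus n r i =
    Nat.card {w : ColoredPerm (n + 1) r //
      Asc w ⊆ Finset.Icc 1 n ∧ (Asc w).card = i ∧ NoTwoConsecutive (Asc w) ∧
        StartsDecreasingToOne w} := by
  have h := card_startsDecreasingToOne (n := n) hr
    (fun S => S ⊆ Finset.Icc 1 n ∧ S.card = i ∧ NoTwoConsecutive S)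
    (fun k S => S.card + 1 = i ∧ (NoTwoConsecutive S ∧ 1 ∉ S) ∧ k ≠ 0 ∧ k ∉ S)
    (fun m l S hml hS hm hmin => by
      subst hml
      have hS' := subset_Icc_pred (S := S) (a := 1) (n := m + l + 1) (by omega)
      rw [Nat.add_sub_cancel, and_iff_right hS, succ_mem_iff_shiftDown hm, not_or] at hS'
      rw [hS', card_eq_card_shiftDown_add_one hm hmin, noTwoConsecutive_iff_shiftDown hm hmin]
      tauto)
  simp only [← xiMinus_eq_card] at h
  simp only [and_assoc] at h
  rw [h, gammaMinus]
  exact sum_Icc_choose_mul (c := 1) (ξ := fun k i => xiMinus k r i)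
    (fun k i h => xiMinus_eq_zero h) i

end ColoredEulerian

theorem corollary3p3 (n r : ℕ) (hn : 1 ≤ n) (hr : 2 ≤ r) :
    binomialEulerian n r = binomialEulerianPlus n r + binomialEulerianMinus n r ∧
    binomialEulerianPlus n r =
      ∑ i ∈ Finset.range (n / 2 + 1),
        (gammaPlus n r i : ℕ[X]) * X ^ i * (1 + X) ^ (n - 2 * i) ∧
    binomialEulerianMinus n r =
      ∑ i ∈ Finset.Icc 1 ((n + 1) / 2),
        (gammaMinus n r i : ℕ[X]) * X ^ i * (1 + X) ^ (n + 1 - 2 * i) ∧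
    (∀ i : ℕ, gammaPlus n r i =
      Nat.card {w : ColoredPerm (n + 1) r //
        (Asc w).card = i + 1 ∧ NoTwoConsecutive (Asc w) ∧ n + 1 ∈ Asc w ∧
          StartsDecreasingToOne w}) ∧
    (∀ i : ℕ, 1 ≤ i → gammaMinus n r i =
      Nat.card {w : ColoredPerm (n + 1) r //
        Asc w ⊆ Finset.Icc 1 n ∧ (Asc w).card = i ∧ NoTwoConsecutive (Asc w) ∧
          StartsDecreasingToOne w}) := by
  have hr1 : 1 ≤ r := by omega
  exact ⟨binomialEulerian_eq_add n hr1, binomialEulerianPlus_eq n r, binomialEulerianMinus_eq n r,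
    fun i => gammaPlus_eq_card n i hr1, fun i _ => gammaMinus_eq_card n i hr1⟩
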